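/- Let $d\ge 1$ and $\lambda>0$. For measurable $v:\mathbb R^d\to\mathbb C$ put $$\mathcal E(v)=\|\nabla v\|_{L^2(\mathbb R^d)}^2+\lambda\int_{\mathbb R^d}\bigl(|v|^2\ln|v|^2-|v|^2+1\bigr)\,dx\in[0,\infty],$$ and let $E=\{v\in H^1_{\rm loc}(\mathbb R^d):\ \mathcal E(v)<\infty\}$ (with the convention $0\ln 0=0$). Let $I\subset\mathbb R$ be an open interval containing $0$ (for instance $I=\mathbb R$). We say that $u\in L^\infty_{\rm loc}(I,E)$ (that is, $u$ is measurable on $I\times\mathbb R^d$, $u(t)\in E$ for almost every $t\in I$, and $t\mapsto\mathcal E(u(t))$ is essentially bounded on each compact subset of $I$) is a weak solution on $I$, with initial datum $u_0\in E$, of $$i\partial_t u+\Delta u=\lambda u\ln|u|^2,\qquad u_{|t=0}=u_0,\qquad(\mathrm{logGP})$$ if the equation holds in $\mathcal D'(I\times\mathbb R^d)$ and $\lim_{t\to0}\int u(t,x)\psi(x)\,dx=\int u_0(x)\psi(x)\,dx$ for all $\psi\in C_c^\infty(\mathbb R^d)$ (the limit being taken up to null sets of times $t$). Let $\omega\in\mathbb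 R$, $c\in\mathbb R^d$ and $\phi\in E$. If $u$ is a weak solution of (logGP) on $I$, with some initial datum $u_0\in E$, and $$u(t,x)=e^{i\omega t}\phi(x-ct)\qquad\text{for almost every }(t,x)\in I\times\mathbb R^d$$ (a solitary wave if $c=0$, a traveling wave if $c\ne0$), then $\omega=0$. -/

import Mathlib

open MeasureTheory Filter Topology Set
open scoped ENNReal

noncomputable section

namespace LogGP

/-- The Euclidean space `ℝ^d`. -/
abbrev Space (d : ℕ) : Type := EuclideanSpace ℝ (Fin d)

/-- Complex-valued test functions: smooth with compact support. -/
def IsTestFunction {V : Type*} [NormedAddCommGroup V] [NormedSpace ℝ V] (ψ : V → ℂ) : Prop :=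
  ContDiff ℝ (⊤ : ℕ∞) ψ ∧ HasCompactSupport ψ

/-- The classical partial derivative `∂ᵢ ψ` at `x`. -/
def partialDeriv {d : ℕ} (i : Fin d) (ψ : Space d → ℂ) (x : Space d) : ℂ :=
  fderiv ℝ ψ x (EuclideanSpace.single i 1)

/-- `g` is the gradient of `v` in the sense of distributions on `ℝ^d`. -/
structure HasWeakGradient {d : ℕ} (v : Space d → ℂ) (g : Space d → EuclideanSpace ℂ (Fin d)) :
    Prop where
  locallyIntegrable : LocallyIntegrable v volume
  locallyIntegrable_grad : LocallyIntegrable g volume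
  integral_eq : ∀ ψ : Space d → ℂ, IsTestFunction ψ → ∀ i : Fin d,
    ∫ x, v x * partialDeriv i ψ x = -∫ x, g x i * ψ x

/-- The space `L²_loc(ℝ^d; F)`. -/
def MemL2Loc {d : ℕ} {F : Type*} [NormedAddCommGroup F] (v : Space d → F) : Prop :=
  ∀ K : Set (Space d), IsCompact K → MemLp v 2 (volume.restrict K)

/-- The space `H¹_loc(ℝ^d)`. -/
def MemH1Loc {d : ℕ} (v : Space d → ℂ) : Prop :=
  MemL2Loc v ∧ ∃ g : Space d → EuclideanSpace ℂ (Fin d), HasWeakGradient v g ∧ MemL2Loc g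

/-- `‖∇v‖²` in `L²(ℝ^d)`, with value `∞` if `∇v` is not square integrable. The weak gradient is
unique up to null sets, so the infimum is over a single value, or over the empty set if `v` has no
locally integrable weak gradient. -/
def gradNormSq {d : ℕ} (v : Space d → ℂ) : ℝ≥0∞ :=
  ⨅ (g : Space d → EuclideanSpace ℂ (Fin d)) (_ : HasWeakGradient v g), ∫⁻ x, ‖g x‖ₑ ^ 2

/-- `F(y) = y ln y - y + 1` for `y > 0`, and `F(0) = 1`. -/
def potential (y : ℝ) : ℝ := y * Real.log y - y + 1

theorem potential_zero : potential 0 = 1 := by simp [potential]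

theorem potential_nonneg {y : ℝ} (hy : 0 ≤ y) : 0 ≤ potential y := by
  rcases hy.eq_or_lt with rfl | hy
  · simp [potential]
  · have h := mul_le_mul_of_nonneg_left (Real.one_sub_inv_le_log_of_pos hy) hy.le
    rw [mul_sub, mul_inv_cancel₀ hy.ne'] at h
    unfold potential
    linarith

/-- The energy `‖∇v‖²_{L²} + λ ∫ (|v|² ln|v|² - |v|² + 1) dx`, with values in `[0, ∞]`. -/
def energy {d : ℕ} (lam : ℝ) (v : Space d → ℂ) : ℝ≥0∞ :=
  gradNormSq v + ENNReal.ofReal lam * ∫⁻ x, ENNReal.ofReal (potential (‖v x‖ ^ 2))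

/-- The energy space: functions in `H¹_loc(ℝ^d)` of finite energy. -/
def EnergySpace (d : ℕ) (lam : ℝ) : Set (Space d → ℂ) :=
  {v | MemH1Loc v ∧ energy lam v < ∞}

/-- `u ∈ L^∞_loc(I, E)`, where `E` is the energy space: `u` is measurable on `I × ℝ^d`, and on each
compact subset of `I` one has, for almost every `t`, `u(t) ∈ E` with a uniform energy bound. -/
def MemLinftyLocEnergy {d : ℕ} (lam : ℝ) (I : Set ℝ) (u : ℝ → Space d → ℂ) : Prop :=
  AEStronglyMeasurable (fun z : ℝ × Space d => u z.1 z.2) (volume.restrict (I ×ˢ univ)) ∧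
  ∀ J : Set ℝ, IsCompact J → J ⊆ I → ∃ C : ℝ≥0∞, C < ∞ ∧
    ∀ᵐ t ∂(volume.restrict J), u t ∈ EnergySpace d lam ∧ energy lam (u t) ≤ C

/-- The nonlinearity `z ln|z|²`, equal to `0` at `z = 0`. -/
def zlog (z : ℂ) : ℂ := z * (Real.log (‖z‖ ^ 2) : ℂ)

/-- The time derivative of a function on `ℝ × ℝ^d`. -/
def timeDeriv {d : ℕ} (Ψ : ℝ × Space d → ℂ) (z : ℝ × Space d) : ℂ :=
  deriv (fun s => Ψ (s, z.2)) z.1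

/-- The Laplacian in the space variable of a function on `ℝ × ℝ^d`. -/
def spaceLaplacian {d : ℕ} (Ψ : ℝ × Space d → ℂ) (z : ℝ × Space d) : ℂ :=
  Laplacian.laplacian (fun y => Ψ (z.1, y)) z.2

/-- Weak solutions on the open interval `I ∋ 0` of
`i ∂ₜu + Δu = λ u ln|u|²` with `u(0) = u₀`. The equation holds in the distributions on `I × ℝ^d`.
As `u` is determined only up to null sets of times, the limit at `0` disregards such sets. -/
structure IsWeakSolution {d : ℕ} (lam : ℝ) (I : Set ℝ) (u₀ : Space d → ℂ)
    (u : ℝ → Space d → ℂ) : Prop where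
  memLinftyLoc : MemLinftyLocEnergy lam I u
  equation : ∀ Ψ : ℝ × Space d → ℂ, IsTestFunction Ψ → tsupport Ψ ⊆ I ×ˢ univ →
    ∫ z : ℝ × Space d, u z.1 z.2 * (-Complex.I * timeDeriv Ψ z + spaceLaplacian Ψ z) =
      (lam : ℂ) * ∫ z : ℝ × Space d, zlog (u z.1 z.2) * Ψ z
  initial : ∀ ψ : Space d → ℂ, IsTestFunction ψ →
    Tendsto (fun t => ∫ x, u t x * ψ x) (𝓝[≠] 0 ⊓ ae volume) (𝓝 (∫ x, u₀ x * ψ x))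

/-- The profile `e^{iωt} φ(x - ct)` of a solitary (`c = 0`) or traveling (`c ≠ 0`) wave. -/
def travelingWave {d : ℕ} (ω : ℝ) (c : Space d) (φ : Space d → ℂ) (t : ℝ) (x : Space d) : ℂ :=
  Complex.exp (Complex.I * (ω * t : ℝ)) * φ (x - t • c)

end LogGP

end

/-!
A finite-energy profile `φ` has `∇φ ∈ L²` and `|φ|` close to `1` far away, while the frequency `ω`
multiplies the only term of the profile equation

`-ωφ - i c·∇φ + Δφ = λ φ ln|φ|²`

that does not vanish at infinity. Hence `ω = 0`.

To make this precise, testing the evolution equation with `θ(t) e^{-iωt} ψ(x - ct)`, where `θ` has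
unit integral and support in `I`, gives the profile equation in the sense of distributions
(`IsWeakSolution.stationary`, `IsWeakSolution.stationary_grad`). It would be natural to test it with
`χ(x - y) conj φ(x)`, `χ` a cutoff on the unit ball and `y` far away, but this is not smooth, and
`φ ln|φ|² conj φ` is awkward to control. Instead, `conj φ` is replaced by `Λ(ρ * φ)`, where `ρ` is
a mollifier and `Λ` a smooth compactly supported truncation of the conjugation which is exact on
`|z| ≤ 2`. This is a genuine test function, bounded uniformly in `ρ`, and its gradient is controlled
by `∇(ρ * φ) = ρ * ∇φ`.

Let `w = |∇φ|² + F(|φ|²)` be the energy density, with `F(y) = y ln y - y + 1`; it is integrable, so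
there are unit balls `B` with `∫_B w ≤ η²` for any `η > 0`. As `(s - 1)² ≤ F(s²)`, the quantities
`|∇φ|`, `||φ| - 1|` and `|φ ln|φ|²|` are all at most a multiple of `η + w / η`, whose integral over
`B` is `O(η)`. So all terms of the tested equation except the one with `ω` are `O(η)`, uniformly in
the mollifier (`exists_norm_mul_integral_localTest_le`). Removing the mollifier
(`tendsto_integral_localTest`), the factor of `ω` tends to `∫ φ Λ(φ) χ(· - y)`, whose modulus is at
least `∫ χ - O(η)` (`le_norm_integral_localTest`). Letting `η → 0` gives `|ω| ∫ χ ≤ 0`.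
-/

noncomputable section

namespace LogGP

open scoped Convolution

variable {d : ℕ}

/-! ### Test functions and their derivatives -/

theorem IsTestFunction.partialDeriv {ψ : Space d → ℂ} (hψ : IsTestFunction ψ) (i : Fin d) :
    IsTestFunction (LogGP.partialDeriv i ψ) := by
  refine ⟨?_, ?_⟩
  · have h : ContDiff ℝ (⊤ : ℕ∞) (fderiv ℝ ψ) := hψ.1.fderiv_right (by simp)
    exact h.clm_apply contDiff_const
  · exact (hψ.2.fderiv (𝕜 := ℝ)).comp_left (g := fun l : Space d →L[ℝ] ℂ => l (EuclideanSpace.single i 1)) rfl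

theorem laplacian_eq_sum_partialDeriv {ψ : Space d → ℂ} (hψ : ContDiff ℝ (⊤ : ℕ∞) ψ) (x : Space d) :
    Laplacian.laplacian ψ x = ∑ i, partialDeriv i (partialDeriv i ψ) x := by
  rw [InnerProductSpace.laplacian_eq_iteratedFDeriv_orthonormalBasis ψ
    (EuclideanSpace.basisFun (Fin d) ℝ)]
  refine Finset.sum_congr rfl fun i _ => ?_
  have h : ContDiff ℝ (⊤ : ℕ∞) (fderiv ℝ ψ) := hψ.fderiv_right (by simp)
  have h1 : DifferentiableAt ℝ (fderiv ℝ ψ) x := h.differentiable (by simp) x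
  rw [iteratedFDeriv_two_apply]
  unfold partialDeriv
  rw [fderiv_clm_apply h1 (differentiableAt_const _)]
  simp

theorem fderiv_eq_sum_partialDeriv (ψ : Space d → ℂ) (x c : Space d) :
    fderiv ℝ ψ x c = ∑ i, (c i : ℂ) * partialDeriv i ψ x := by
  conv_lhs => rw [← (EuclideanSpace.basisFun (Fin d) ℝ).sum_repr c]
  simp [partialDeriv]

theorem partialDeriv_comp_sub (ψ : Space d → ℂ) (a : Space d) (i : Fin d) :
    partialDeriv i (fun x => ψ (x - a)) = fun x => partialDeriv i ψ (x - a) := by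
  ext x; simp [partialDeriv, fderiv_comp_sub]

theorem laplacian_comp_sub {ψ : Space d → ℂ} (hψ : ContDiff ℝ (⊤ : ℕ∞) ψ) (a x : Space d) :
    Laplacian.laplacian (fun x => ψ (x - a)) x = Laplacian.laplacian ψ (x - a) := by
  have h : ContDiff ℝ (⊤ : ℕ∞) (fun x => ψ (x - a)) := hψ.comp (by fun_prop)
  rw [laplacian_eq_sum_partialDeriv hψ, laplacian_eq_sum_partialDeriv h]
  simp [partialDeriv_comp_sub]

theorem IsTestFunction.integrable_mul {V : Type*} [NormedAddCommGroup V] [NormedSpace ℝ V]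
    [MeasurableSpace V] [BorelSpace V] {μ : Measure V} {f ψ : V → ℂ}
    (hψ : IsTestFunction ψ) (hf : LocallyIntegrable f μ) : Integrable (fun x => f x * ψ x) μ := by
  have := hf.integrable_smul_right_of_hasCompactSupport hψ.1.continuous hψ.2
  simpa using this

theorem zlog_mul_of_norm_eq_one {a : ℂ} (ha : ‖a‖ = 1) (z : ℂ) : zlog (a * z) = a * zlog z := by
  simp [zlog, ha, mul_assoc]

/-! ### The profile equation -/

/-- The change of variables to the frame moving with velocity `c`. -/
theorem measurePreserving_shear (c : Space d) :
    MeasurePreserving (fun z : ℝ × Space d => (z.1, z.2 - z.1 • c)) := by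
  refine (MeasurePreserving.id volume).skew_product (g := fun t x => x - t • c) (by fun_prop) ?_
  exact Eventually.of_forall fun t => (measurePreserving_sub_right volume (t • c)).map_eq

theorem measurableEmbedding_shear (c : Space d) :
    MeasurableEmbedding (fun z : ℝ × Space d => (z.1, z.2 - z.1 • c)) := by
  let e : (ℝ × Space d) ≃ₜ (ℝ × Space d) :=
    { toFun := fun z => (z.1, z.2 - z.1 • c)
      invFun := fun z => (z.1, z.2 + z.1 • c)
      left_inv := fun z => by simp
      right_inv := fun z => by simp
      continuous_toFun := by fun_prop
      continuous_invFun := by fun_prop }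
  exact e.measurableEmbedding

theorem integral_comp_shear (c : Space d) (F : ℝ × Space d → ℂ) :
    ∫ z : ℝ × Space d, F (z.1, z.2 - z.1 • c) = ∫ z, F z :=
  (measurePreserving_shear c).integral_comp (measurableEmbedding_shear c) F

/-- A smooth real cutoff with unit integral, supported in a given neighbourhood of `0`. -/
theorem exists_cutoff {I : Set ℝ} (hI : IsOpen I) (h0 : (0 : ℝ) ∈ I) :
    ∃ θ : ℝ → ℝ, ContDiff ℝ (⊤ : ℕ∞) θ ∧ HasCompactSupport θ ∧ tsupport θ ⊆ I ∧ ∫ t, θ t = 1 := by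
  obtain ⟨r, hr, hrI⟩ := Metric.nhds_basis_closedBall.mem_iff.1 (hI.mem_nhds h0)
  let f : ContDiffBump (0 : ℝ) := ⟨r / 2, r, by positivity, by linarith⟩
  refine ⟨f.normed volume, f.contDiff_normed, f.hasCompactSupport_normed, ?_, f.integral_normed⟩
  rw [f.tsupport_normed_eq]
  exact hrI

/-- The test function `θ(t) e^{-iωt} ψ(x - ct)`, dual to a traveling wave with parameters `ω`, `c`. -/
def waveTest (ω : ℝ) (c : Space d) (θ : ℝ → ℝ) (ψ : Space d → ℂ) (z : ℝ × Space d) : ℂ :=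
  θ z.1 * Complex.exp (-(Complex.I * (ω * z.1 : ℝ))) * ψ (z.2 - z.1 • c)

theorem tsupport_waveTest_subset (ω : ℝ) (c : Space d) (θ : ℝ → ℝ) (ψ : Space d → ℂ) :
    tsupport (waveTest ω c θ ψ) ⊆ tsupport θ ×ˢ univ := by
  refine closure_minimal (fun z hz => ⟨subset_tsupport _ fun h => hz ?_, mem_univ _⟩)
    ((isClosed_tsupport θ).prod isClosed_univ)
  simp [waveTest, h]

theorem isTestFunction_waveTest (ω : ℝ) (c : Space d) {θ : ℝ → ℝ} (hθ : ContDiff ℝ (⊤ : ℕ∞) θ)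
    (hθc : HasCompactSupport θ) {ψ : Space d → ℂ} (hψ : IsTestFunction ψ) :
    IsTestFunction (waveTest ω c θ ψ) := by
  refine ⟨?_, ?_⟩
  · have h1 : ContDiff ℝ (⊤ : ℕ∞) (fun z : ℝ × Space d => (θ z.1 : ℂ)) :=
      Complex.ofRealCLM.contDiff.comp (hθ.comp contDiff_fst)
    have h2 : ContDiff ℝ (⊤ : ℕ∞)
        (fun z : ℝ × Space d => Complex.exp (-(Complex.I * (ω * z.1 : ℝ)))) := by
      refine Complex.contDiff_exp.comp (contDiff_const.mul
        (Complex.ofRealCLM.contDiff.comp (contDiff_const.mul contDiff_fst))).neg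
    have h3 : ContDiff ℝ (⊤ : ℕ∞) (fun z : ℝ × Space d => ψ (z.2 - z.1 • c)) :=
      hψ.1.comp (contDiff_snd.sub (contDiff_fst.smul contDiff_const))
    exact (h1.mul h2).mul h3
  · refine HasCompactSupport.intro
      ((hθc.isCompact.prod hψ.2.isCompact).image
        (f := fun z : ℝ × Space d => (z.1, z.2 + z.1 • c)) (by fun_prop)) fun z hz => ?_
    by_contra hne
    refine hz ⟨(z.1, z.2 - z.1 • c), ⟨subset_tsupport _ fun h => hne ?_,
      subset_tsupport _ fun h => hne ?_⟩, by simp⟩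
    · simp [waveTest, h]
    · simp [waveTest, h]

theorem timeDeriv_waveTest (ω : ℝ) (c : Space d) {θ : ℝ → ℝ} (hθ : ContDiff ℝ (⊤ : ℕ∞) θ)
    {ψ : Space d → ℂ} (hψ : ContDiff ℝ (⊤ : ℕ∞) ψ) (z : ℝ × Space d) :
    timeDeriv (waveTest ω c θ ψ) z = Complex.exp (-(Complex.I * (ω * z.1 : ℝ))) *
      ((deriv θ z.1 : ℝ) * ψ (z.2 - z.1 • c) - θ z.1 * (Complex.I * ω * ψ (z.2 - z.1 • c) +
        fderiv ℝ ψ (z.2 - z.1 • c) c)) := by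
  have h1 : HasDerivAt (fun s => (θ s : ℂ)) ((deriv θ z.1 : ℝ) : ℂ) z.1 :=
    ((hθ.differentiable (by simp)) z.1).hasDerivAt.ofReal_comp
  have h2 : HasDerivAt (fun s : ℝ => Complex.exp (-(Complex.I * (ω * s : ℝ))))
      (Complex.exp (-(Complex.I * (ω * z.1 : ℝ))) * (-(Complex.I * (ω * 1 : ℝ)))) z.1 :=
    ((((hasDerivAt_id z.1).const_mul ω).ofReal_comp).const_mul Complex.I).neg.cexp
  have h3 : HasDerivAt (fun s : ℝ => ψ (z.2 - s • c)) (fderiv ℝ ψ (z.2 - z.1 • c) (-c)) z.1 := by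
    have h4 : HasDerivAt (fun s : ℝ => z.2 - s • c) (-c) z.1 := by
      simpa using ((hasDerivAt_id z.1).smul_const c).const_sub z.2
    exact ((hψ.differentiable (by simp)) _).hasFDerivAt.comp_hasDerivAt z.1 h4
  have := ((h1.mul h2).mul h3).deriv
  unfold timeDeriv waveTest
  refine this.trans ?_
  simp only [map_neg, Pi.mul_apply]
  push_cast
  ring

theorem spaceLaplacian_waveTest (ω : ℝ) (c : Space d) (θ : ℝ → ℝ)
    {ψ : Space d → ℂ} (hψ : ContDiff ℝ (⊤ : ℕ∞) ψ) (z : ℝ × Space d) :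
    spaceLaplacian (waveTest ω c θ ψ) z = Complex.exp (-(Complex.I * (ω * z.1 : ℝ))) *
      (θ z.1 * Laplacian.laplacian ψ (z.2 - z.1 • c)) := by
  have h : ContDiff ℝ (⊤ : ℕ∞) (fun x => ψ (x - z.1 • c)) := hψ.comp (by fun_prop)
  have := InnerProductSpace.laplacian_smul (f := fun x => ψ (x - z.1 • c)) (x := z.2)
    (θ z.1 * Complex.exp (-(Complex.I * (ω * z.1 : ℝ)))) (contDiff_infty.1 h 2).contDiffAt
  rw [laplacian_comp_sub hψ] at this
  unfold spaceLaplacian waveTest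
  refine this.trans ?_
  rw [smul_eq_mul]
  ring

/-- Expansion of the tested profile operator into partial derivatives of `ψ`. -/
theorem mul_waveOperator_eq (ω : ℝ) (c : Space d) (φ : Space d → ℂ) {ψ : Space d → ℂ}
    (hψ : IsTestFunction ψ) (x : Space d) :
    φ x * (-ω * ψ x + Complex.I * fderiv ℝ ψ x c + Laplacian.laplacian ψ x) =
      -ω * (φ x * ψ x) + Complex.I * (∑ i, c i * (φ x * partialDeriv i ψ x)) +
        ∑ i, φ x * partialDeriv i (partialDeriv i ψ) x := by
  rw [laplacian_eq_sum_partialDeriv hψ.1, fderiv_eq_sum_partialDeriv, ← Finset.mul_sum]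
  have : ∑ i, (c i : ℂ) * (φ x * partialDeriv i ψ x) =
      φ x * ∑ i, (c i : ℂ) * partialDeriv i ψ x := by
    rw [Finset.mul_sum]; exact Finset.sum_congr rfl fun i _ => by ring
  rw [this]; ring

/-- The profile of a traveling wave solves `-ωφ - i c·∇φ + Δφ = λ φ ln|φ|²` in the sense of
distributions. -/
theorem IsWeakSolution.stationary {lam : ℝ} {I : Set ℝ} (hIopen : IsOpen I) (hI0 : (0 : ℝ) ∈ I)
    {ω : ℝ} {c : Space d} {φ : Space d → ℂ} (hφ : LocallyIntegrable φ volume)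
    {u₀ : Space d → ℂ} {u : ℝ → Space d → ℂ} (hu : IsWeakSolution lam I u₀ u)
    (hwave : ∀ᵐ z : ℝ × Space d ∂(volume.restrict (I ×ˢ univ)),
      u z.1 z.2 = travelingWave ω c φ z.1 z.2) {ψ : Space d → ℂ} (hψ : IsTestFunction ψ) :
    ∫ x, φ x * (-ω * ψ x + Complex.I * fderiv ℝ ψ x c + Laplacian.laplacian ψ x) =
      lam * ∫ x, zlog (φ x) * ψ x := by
  obtain ⟨θ, hθ, hθc, hθI, hθ1⟩ := exists_cutoff hIopen hI0
  have hθ0 : ∀ t ∉ I, θ t = 0 := fun t ht => image_eq_zero_of_notMem_tsupport fun h => ht (hθI h)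
  have hθ0' : ∀ t ∉ I, deriv θ t = 0 := fun t ht =>
    image_eq_zero_of_notMem_tsupport fun h => ht (hθI (tsupport_deriv_subset h))
  have hθint : ∫ t, (θ t : ℂ) = 1 := by rw [integral_complex_ofReal, hθ1]; simp
  have hcont' : Continuous (deriv θ) := hθ.continuous_deriv (by simp)
  have hdint : Integrable (deriv θ) := hcont'.integrable_of_hasCompactSupport hθc.deriv
  have hdC : Integrable fun t => ((deriv θ t : ℝ) : ℂ) := hdint.ofReal
  have hθC : Integrable fun t => (θ t : ℂ) :=
    (hθ.continuous.integrable_of_hasCompactSupport hθc).ofReal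
  have hθdint : ∫ t, ((deriv θ t : ℝ) : ℂ) = 0 := by
    rw [integral_complex_ofReal, integral_eq_zero_of_hasDerivAt_of_integrable
      (fun t => ((hθ.differentiable (by simp)) t).hasDerivAt) hdint
      (hθ.continuous.integrable_of_hasCompactSupport hθc)]
    simp
  have hae : ∀ᵐ z : ℝ × Space d, z.1 ∈ I → u z.1 z.2 = travelingWave ω c φ z.1 z.2 := by
    have := (ae_restrict_iff' (hIopen.measurableSet.prod MeasurableSet.univ)).1 hwave
    filter_upwards [this] with z hz h using hz ⟨h, mem_univ _⟩
  have hexp : ∀ t : ℝ, Complex.exp (Complex.I * (ω * t : ℝ)) *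
      Complex.exp (-(Complex.I * (ω * t : ℝ))) = 1 := fun t => by
    rw [← Complex.exp_add, add_neg_cancel, Complex.exp_zero]
  have hnorm : ∀ t : ℝ, ‖Complex.exp (Complex.I * (ω * t : ℝ))‖ = 1 := fun t => by
    rw [mul_comm]; exact Complex.norm_exp_ofReal_mul_I _
  have key := hu.equation _ (isTestFunction_waveTest ω c hθ hθc hψ)
    ((tsupport_waveTest_subset ω c θ ψ).trans (prod_mono hθI le_rfl))
  set A : Space d → ℂ := fun x => -Complex.I * (φ x * ψ x) with hA
  set B : Space d → ℂ := fun x =>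
    φ x * (-ω * ψ x + Complex.I * fderiv ℝ ψ x c + Laplacian.laplacian ψ x) with hB
  have hAint : Integrable A := (hψ.integrable_mul hφ).const_mul _
  have hBint : Integrable B := by
    simp_rw [hB, mul_waveOperator_eq ω c φ hψ]
    exact (((hψ.integrable_mul hφ).const_mul _).add ((integrable_finsetSum _ fun i _ =>
      ((hψ.partialDeriv i).integrable_mul hφ).const_mul _).const_mul _)).add
      (integrable_finsetSum _ fun i _ => ((hψ.partialDeriv i).partialDeriv i).integrable_mul hφ)
  -- In the moving frame both integrands are sums of products of a function of `t` and one of `x`.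
  have hL : ∀ᵐ z : ℝ × Space d, u z.1 z.2 * (-Complex.I * timeDeriv (waveTest ω c θ ψ) z +
      spaceLaplacian (waveTest ω c θ ψ) z) =
      (fun p : ℝ × Space d => ((deriv θ p.1 : ℝ) : ℂ) * A p.2 + (θ p.1 : ℂ) * B p.2)
        (z.1, z.2 - z.1 • c) := by
    filter_upwards [hae] with z hz
    rw [timeDeriv_waveTest ω c hθ hψ.1, spaceLaplacian_waveTest ω c θ hψ.1]
    by_cases hI : z.1 ∈ I
    · rw [hz hI, travelingWave]
      simp only [hA, hB]
      linear_combination (exp := 1) (-Complex.I * (φ (z.2 - z.1 • c)) *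
        ((deriv θ z.1 : ℝ) * ψ (z.2 - z.1 • c) - θ z.1 * (Complex.I * ω * ψ (z.2 - z.1 • c) +
        fderiv ℝ ψ (z.2 - z.1 • c) c)) + φ (z.2 - z.1 • c) *
          (θ z.1 * Laplacian.laplacian ψ (z.2 - z.1 • c))) * hexp z.1 +
          φ (z.2 - z.1 • c) * θ z.1 * ω * ψ (z.2 - z.1 • c) * Complex.I_sq
    · simp [hθ0 _ hI, hθ0' _ hI]
  have hR : ∀ᵐ z : ℝ × Space d, zlog (u z.1 z.2) * waveTest ω c θ ψ z =
      (fun p : ℝ × Space d => (θ p.1 : ℂ) * (zlog (φ p.2) * ψ p.2)) (z.1, z.2 - z.1 • c) := by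
    filter_upwards [hae] with z hz
    by_cases hI : z.1 ∈ I
    · rw [hz hI, travelingWave, zlog_mul_of_norm_eq_one (hnorm _), waveTest]
      linear_combination (θ z.1 * (zlog (φ (z.2 - z.1 • c)) * ψ (z.2 - z.1 • c))) * hexp z.1
    · simp [waveTest, hθ0 _ hI]
  have hsL := integral_comp_shear c
    fun p => ((deriv θ p.1 : ℝ) : ℂ) * A p.2 + (θ p.1 : ℂ) * B p.2
  have hsR := integral_comp_shear c fun p => (θ p.1 : ℂ) * (zlog (φ p.2) * ψ p.2)
  rw [integral_congr_ae hL, integral_congr_ae hR] at key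
  replace key := (hsL.symm.trans key).trans (congrArg (fun w => (lam : ℂ) * w) hsR)
  -- `∫ θ' = 0` removes the term with the time derivative of the cutoff, and `∫ θ = 1`.
  rw [Measure.volume_eq_prod, integral_add (hdC.mul_prod hAint) (hθC.mul_prod hBint),
    integral_prod_mul (fun t => ((deriv θ t : ℝ) : ℂ)) A, integral_prod_mul (fun t => (θ t : ℂ)) B,
    integral_prod_mul (fun t => (θ t : ℂ)) (fun x => zlog (φ x) * ψ x), hθint, hθdint] at key
  simpa using key

/-- Integrating by parts, the stationary equation in terms of the weak gradient. -/
theorem IsWeakSolution.stationary_grad {lam : ℝ} {I : Set ℝ} (hIopen : IsOpen I)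
    (hI0 : (0 : ℝ) ∈ I) {ω : ℝ} {c : Space d} {φ : Space d → ℂ}
    {g : Space d → EuclideanSpace ℂ (Fin d)} (hg : HasWeakGradient φ g)
    {u₀ : Space d → ℂ} {u : ℝ → Space d → ℂ} (hu : IsWeakSolution lam I u₀ u)
    (hwave : ∀ᵐ z : ℝ × Space d ∂(volume.restrict (I ×ˢ univ)),
      u z.1 z.2 = travelingWave ω c φ z.1 z.2) {ψ : Space d → ℂ} (hψ : IsTestFunction ψ) :
    ω * ∫ x, φ x * ψ x = -Complex.I * (∑ i, c i * ∫ x, g x i * ψ x)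
      - (∑ i, ∫ x, g x i * partialDeriv i ψ x) - lam * ∫ x, zlog (φ x) * ψ x := by
  have hφ := hg.locallyIntegrable
  have key := hu.stationary hIopen hI0 hφ hwave hψ
  have h1 : ∀ i, Integrable fun x => φ x * partialDeriv i ψ x := fun i =>
    (hψ.partialDeriv i).integrable_mul hφ
  have h2 : ∀ i, Integrable fun x => φ x * partialDeriv i (partialDeriv i ψ) x := fun i =>
    ((hψ.partialDeriv i).partialDeriv i).integrable_mul hφ
  simp_rw [mul_waveOperator_eq ω c φ hψ] at key
  have h3 : Integrable fun x => ∑ i, (c i : ℂ) * (φ x * partialDeriv i ψ x) :=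
    integrable_finsetSum _ fun i _ => (h1 i).const_mul _
  have h4 : Integrable fun x => ∑ i, φ x * partialDeriv i (partialDeriv i ψ) x :=
    integrable_finsetSum _ fun i _ => h2 i
  have h5 : Integrable fun x => -(ω : ℂ) * (φ x * ψ x) +
      Complex.I * ∑ i, (c i : ℂ) * (φ x * partialDeriv i ψ x) :=
    ((hψ.integrable_mul hφ).const_mul _).add (h3.const_mul _)
  rw [integral_add h5 h4, integral_add ((hψ.integrable_mul hφ).const_mul _) (h3.const_mul _), integral_const_mul,
    integral_const_mul, integral_finsetSum _ fun i _ => (h1 i).const_mul _,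
    integral_finsetSum _ fun i _ => h2 i] at key
  simp_rw [integral_const_mul, hg.integral_eq _ hψ,
    hg.integral_eq _ (hψ.partialDeriv _)] at key
  simp only [mul_neg, Finset.sum_neg_distrib] at key
  linear_combination -key

/-! ### Mollification -/

/-- The weak gradient commutes with mollification. -/
theorem HasWeakGradient.partialDeriv_convolution {φ : Space d → ℂ}
    {g : Space d → EuclideanSpace ℂ (Fin d)} (hg : HasWeakGradient φ g) {ρ : Space d → ℝ}
    (hρ : ContDiff ℝ (⊤ : ℕ∞) ρ) (hρc : HasCompactSupport ρ) (i : Fin d) (x : Space d) :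
    partialDeriv i (ρ ⋆[ContinuousLinearMap.lsmul ℝ ℝ, volume] φ) x = ∫ t, ρ (x - t) * g t i := by
  have h1 : ContDiff ℝ 1 ρ := hρ.of_le (by exact_mod_cast le_top)
  have hfd := hρc.hasFDerivAt_convolution_left (ContinuousLinearMap.lsmul ℝ ℝ : ℝ →L[ℝ] ℂ →L[ℝ] ℂ)
    h1 hg.locallyIntegrable x
  have htest : IsTestFunction fun t => (ρ (x - t) : ℂ) :=
    ⟨Complex.ofRealCLM.contDiff.comp (hρ.comp (contDiff_const.sub contDiff_id)),
      (hρc.comp_homeomorph (Homeomorph.subLeft x)).comp_left Complex.ofReal_zero⟩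
  have hpd : ∀ t, partialDeriv i (fun t => (ρ (x - t) : ℂ)) t =
      -(fderiv ℝ ρ (x - t) (EuclideanSpace.single i 1) : ℂ) := fun t => by
    have h2 : HasFDerivAt (fun t => x - t) (-ContinuousLinearMap.id ℝ (Space d)) t :=
      (hasFDerivAt_id t).const_sub x
    have h3 := Complex.ofRealCLM.hasFDerivAt.comp t
      ((h1.differentiable one_ne_zero (x - t)).hasFDerivAt.comp t h2)
    have h4 : partialDeriv i (fun t => (ρ (x - t) : ℂ)) t = _ :=
      congrArg (fun l : Space d →L[ℝ] ℂ => l (EuclideanSpace.single i 1)) h3.fderiv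
    rw [h4]
    simp
  have hint := hg.integral_eq _ htest i
  simp_rw [hpd] at hint
  have hconv := hρc.fderiv (𝕜 := ℝ) |>.convolutionExists_left
    ((ContinuousLinearMap.lsmul ℝ ℝ : ℝ →L[ℝ] ℂ →L[ℝ] ℂ).precompL (Space d))
    (h1.continuous_fderiv one_ne_zero) hg.locallyIntegrable x
  unfold partialDeriv
  rw [hfd.fderiv, convolution_eq_swap]
  refine (ContinuousLinearMap.integral_apply hconv.integrable_swap _).trans ?_
  simp only [ContinuousLinearMap.precompL_apply, ContinuousLinearMap.lsmul_apply,
    Complex.real_smul]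
  have e1 : ∫ t, ((fderiv ℝ ρ (x - t) (EuclideanSpace.single i 1) : ℝ) : ℂ) * φ t =
      -∫ t, φ t * -((fderiv ℝ ρ (x - t) (EuclideanSpace.single i 1) : ℝ) : ℂ) := by
    rw [← integral_neg]
    exact integral_congr_ae (Eventually.of_forall fun t => by simp [mul_comm])
  have e2 : ∫ t, (ρ (x - t) : ℂ) * g t i = ∫ t, g t i * (ρ (x - t) : ℂ) := by
    simp_rw [mul_comm]
  rw [e1, e2, hint, neg_neg]

theorem mul_le_sq_div_add_mul_sq {η : ℝ} (hη : 0 < η) (a b : ℝ) : a * b ≤ a ^ 2 / η + η * b ^ 2 := by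
  have h : a ^ 2 / η + η * b ^ 2 - a * b = ((a - η * b) ^ 2 + a ^ 2 + (η * b) ^ 2) / (2 * η) := by
    field_simp; ring
  have : 0 ≤ ((a - η * b) ^ 2 + a ^ 2 + (η * b) ^ 2) / (2 * η) := by positivity
  linarith

/-- A substitute for Young's convolution inequality: only the convolution of `ρ` with `‖g‖²` enters,
and its integral is that of `‖g‖²`. -/
theorem mul_norm_partialDeriv_convolution_le {φ : Space d → ℂ}
    {g : Space d → EuclideanSpace ℂ (Fin d)} (hg : HasWeakGradient φ g)
    (hg2 : Integrable fun x => ‖g x‖ ^ 2) {ρ : Space d → ℝ}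
    (hρ : ContDiff ℝ (⊤ : ℕ∞) ρ) (hρc : HasCompactSupport ρ) (hρ0 : ∀ x, 0 ≤ ρ x)
    (hρ1 : ∫ x, ρ x = 1) (i : Fin d) (x : Space d) {a η : ℝ} (ha : 0 ≤ a) (hη : 0 < η) :
    a * ‖partialDeriv i (ρ ⋆[ContinuousLinearMap.lsmul ℝ ℝ, volume] φ) x‖ ≤
      a ^ 2 / η + η * (ρ ⋆[ContinuousLinearMap.lsmul ℝ ℝ, volume] fun x => ‖g x‖ ^ 2) x := by
  have hc : Continuous fun t => ρ (x - t) := hρ.continuous.comp (continuous_const.sub continuous_id)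
  have hcs : HasCompactSupport fun t => ρ (x - t) := hρc.comp_homeomorph (Homeomorph.subLeft x)
  have hi1 : Integrable fun t => ρ (x - t) * ‖g t‖ := by
    simpa [norm_smul, abs_of_nonneg (hρ0 _)] using
      (hg.locallyIntegrable_grad.integrable_smul_left_of_hasCompactSupport hc hcs).norm
  have hi2 : Integrable fun t => ρ (x - t) * ‖g t‖ ^ 2 := by
    simpa using hg2.locallyIntegrable.integrable_smul_left_of_hasCompactSupport hc hcs
  have hi3 : Integrable fun t => ρ (x - t) := hc.integrable_of_hasCompactSupport hcs
  have h1' : ∫ t, ρ (x - t) = 1 := by rw [integral_sub_left_eq_self, hρ1]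
  rw [hg.partialDeriv_convolution hρ hρc, convolution_lsmul_swap]
  have hb : ‖∫ t, (ρ (x - t) : ℂ) * g t i‖ ≤ ∫ t, ρ (x - t) * ‖g t‖ := by
    refine norm_integral_le_of_norm_le hi1 (Eventually.of_forall fun t => ?_)
    rw [norm_mul, Complex.norm_real, Real.norm_of_nonneg (hρ0 _)]
    exact mul_le_mul_of_nonneg_left (PiLp.norm_apply_le (g t) i) (hρ0 _)
  calc a * ‖∫ t, (ρ (x - t) : ℂ) * g t i‖ ≤ a * ∫ t, ρ (x - t) * ‖g t‖ := by gcongr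
    _ = ∫ t, a * (ρ (x - t) * ‖g t‖) := (integral_const_mul _ _).symm
    _ ≤ ∫ t, (a ^ 2 / η * ρ (x - t) + η * (ρ (x - t) * ‖g t‖ ^ 2)) := by
      refine integral_mono (hi1.const_mul _) ((hi3.const_mul _).add (hi2.const_mul _)) fun t => ?_
      have := mul_le_mul_of_nonneg_left (mul_le_sq_div_add_mul_sq hη a ‖g t‖) (hρ0 (x - t))
      dsimp only
      linarith
    _ = a ^ 2 / η + η * ∫ t, ρ (x - t) • ‖g t‖ ^ 2 := by
      rw [integral_add (hi3.const_mul _) (hi2.const_mul _), integral_const_mul,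
        integral_const_mul, h1', mul_one]
      rfl

/-! ### Pointwise estimates by the potential -/

theorem sq_sub_one_le_potential {s : ℝ} (hs : 0 ≤ s) : (s - 1) ^ 2 ≤ potential (s ^ 2) := by
  rcases hs.eq_or_lt with rfl | hs
  · simp [potential]
  · have h := Real.one_sub_inv_le_log_of_pos hs
    have h2 : s ^ 2 * (1 - s⁻¹) ≤ s ^ 2 * Real.log s := by gcongr
    have h3 : s ^ 2 * (1 - s⁻¹) = s ^ 2 - s := by field_simp
    unfold potential
    rw [Real.log_pow]
    push_cast
    linarith

theorem norm_zlog_le (z : ℂ) : ‖zlog z‖ ≤ 2 * |‖z‖ - 1| + 2 * (‖z‖ - 1) ^ 2 := by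
  have hz := norm_nonneg z
  set s := ‖z‖ with hs
  have e : ‖zlog z‖ = s * (2 * |Real.log s|) := by
    rw [zlog, norm_mul, Complex.norm_real, ← hs, Real.log_pow, Real.norm_eq_abs, abs_mul]
    norm_num
  rw [e]
  rcases hz.eq_or_lt with h0 | h0
  · rw [← h0]; simp
  rcases le_total s 1 with h1 | h1
  · have h2 := mul_le_mul_of_nonneg_left (Real.one_sub_inv_le_log_of_pos h0) h0.le
    rw [mul_sub, mul_inv_cancel₀ h0.ne'] at h2
    rw [abs_of_nonpos (Real.log_nonpos h0.le h1), abs_of_nonpos (by linarith)]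
    nlinarith [sq_nonneg (s - 1)]
  · have h2 := mul_le_mul_of_nonneg_left (Real.log_le_sub_one_of_pos h0) h0.le
    rw [abs_of_nonneg (Real.log_nonneg h1), abs_of_nonneg (by linarith)]
    nlinarith

theorem abs_le_add_sq_div {η : ℝ} (hη : 0 < η) (a : ℝ) : |a| ≤ η + a ^ 2 / η := by
  have := mul_le_sq_div_add_mul_sq hη |a| 1
  simpa [add_comm] using this

/-! ### Integrability of the energy density -/

theorem continuous_potential : Continuous potential :=
  (Real.continuous_mul_log.sub continuous_id).add continuous_const

/-- A finite-energy function has a square-integrable weak gradient and an integrable potential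
energy density. -/
theorem exists_integrable_density {lam : ℝ} (hlam : 0 < lam) {φ : Space d → ℂ}
    (hφ : φ ∈ EnergySpace d lam) : ∃ g : Space d → EuclideanSpace ℂ (Fin d),
      HasWeakGradient φ g ∧ Integrable (fun x => ‖g x‖ ^ 2) ∧
        Integrable (fun x => potential (‖φ x‖ ^ 2)) := by
  have hE : gradNormSq φ + ENNReal.ofReal lam * ∫⁻ x, ENNReal.ofReal (potential (‖φ x‖ ^ 2)) < ∞ :=
    hφ.2
  obtain ⟨h1, h2⟩ := ENNReal.add_lt_top.1 hE
  simp only [gradNormSq, iInf_lt_iff] at h1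
  obtain ⟨g, hg, hgfin⟩ := h1
  refine ⟨g, hg, ⟨(hg.locallyIntegrable_grad.aestronglyMeasurable.norm.pow 2), ?_⟩, ⟨?_, ?_⟩⟩
  · simpa [HasFiniteIntegral, enorm_pow] using hgfin
  · exact continuous_potential.comp_aestronglyMeasurable
      (hg.locallyIntegrable.aestronglyMeasurable.norm.pow 2)
  · have hlam' : ENNReal.ofReal lam ≠ 0 := by simpa using hlam
    have h3 := (ENNReal.mul_lt_top_iff.1 h2)
    have h4 : ∫⁻ x, ENNReal.ofReal (potential (‖φ x‖ ^ 2)) < ∞ := by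
      rcases h3 with h | h | h
      · exact h.2
      · exact absurd h hlam'
      · simp [h]
    rw [hasFiniteIntegral_iff_ofReal (Eventually.of_forall fun x => potential_nonneg (by positivity))]
    exact h4

/-- An integrable function on `ℝ^d`, `d ≥ 1`, has arbitrarily small integral over some unit ball. -/
theorem exists_setIntegral_closedBall_le (hd : 1 ≤ d) {w : Space d → ℝ} (hw : Integrable w)
    {ε : ℝ} (hε : 0 < ε) : ∃ y, ∫ x in Metric.closedBall y 1, w x ≤ ε := by
  -- Along a sequence of disjoint balls the integrals are summable, so they tend to `0`.
  let y : ℕ → Space d := fun n => EuclideanSpace.single ⟨0, hd⟩ (3 * n : ℝ)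
  have hdisj : Pairwise fun m n => Disjoint (Metric.closedBall (y m) 1) (Metric.closedBall (y n) 1) := by
    intro m n hmn
    refine Metric.closedBall_disjoint_closedBall ?_
    rw [PiLp.dist_single_same, Real.dist_eq, ← mul_sub, abs_mul]
    have : (1 : ℝ) ≤ |(m : ℝ) - n| := by
      have h := Int.one_le_abs (sub_ne_zero.2 (Nat.cast_injective.ne hmn : (m : ℤ) ≠ n))
      exact_mod_cast h
    norm_num
    linarith
  have hsum := (hasSum_integral_iUnion (f := w) (fun n => Metric.isClosed_closedBall.measurableSet) hdisj
    hw.integrableOn).summable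
  obtain ⟨n, hn⟩ := (hsum.tendsto_atTop_zero.eventually_le_const hε).exists
  exact ⟨y n, hn⟩

/-! ### Localized test functions -/

/-- A smooth truncation of complex conjugation: `Λ z = b(z) conj z` with a cutoff `b` equal to `1`
for `|z| ≤ 2`. Where the cutoff is active, the lower bound holds as its left-hand side is negative. -/
theorem exists_truncated_conj : ∃ Λ : ℂ → ℂ, ContDiff ℝ (⊤ : ℕ∞) Λ ∧ HasCompactSupport Λ ∧
    ∀ z, 1 - 2 * |‖z‖ - 1| ≤ (z * Λ z).re := by
  let b : ContDiffBump (0 : ℂ) := ⟨2, 3, by norm_num, by norm_num⟩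
  refine ⟨fun z => b z * (starRingEnd ℂ) z, ?_, ?_, fun z => ?_⟩
  · exact (Complex.ofRealCLM.contDiff.comp b.contDiff).mul Complex.conjCLE.contDiff
  · exact (b.hasCompactSupport.comp_left Complex.ofReal_zero).mul_right
  · have e : (z * (b z * (starRingEnd ℂ) z)).re = b z * ‖z‖ ^ 2 := by
      rw [mul_left_comm, Complex.mul_conj, Complex.normSq_eq_norm_sq, ← Complex.ofReal_mul,
        Complex.ofReal_re]
    rw [e]
    have hz := norm_nonneg z
    rcases le_total ‖z‖ 2 with h | h
    · have : b z = 1 := b.one_of_mem_closedBall (by simpa using h)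
      rw [this, one_mul]
      rcases abs_cases (‖z‖ - 1) with ⟨h1, _⟩ | ⟨h1, _⟩ <;> rw [h1] <;> nlinarith
    · have h1 : 0 ≤ b z * ‖z‖ ^ 2 := mul_nonneg b.nonneg (by positivity)
      have h2 := le_abs_self (‖z‖ - 1)
      linarith

theorem exists_unit_cutoff (d : ℕ) : ∃ χ : Space d → ℝ, ContDiff ℝ (⊤ : ℕ∞) χ ∧
    HasCompactSupport χ ∧ (∀ x, 0 ≤ χ x) ∧ (∀ x, χ x ≤ 1) ∧
      tsupport χ ⊆ Metric.closedBall 0 1 ∧ 0 < ∫ x, χ x := by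
  let b : ContDiffBump (0 : Space d) := ⟨1 / 2, 1, by norm_num, by norm_num⟩
  exact ⟨b, b.contDiff, b.hasCompactSupport, fun _ => b.nonneg, fun _ => b.le_one,
    b.tsupport_eq.subset, b.integral_pos⟩

theorem exists_bound_fderiv {V F : Type*} [NormedAddCommGroup V] [NormedSpace ℝ V]
    [NormedAddCommGroup F] [NormedSpace ℝ F] {f : V → F} (hf : ContDiff ℝ (⊤ : ℕ∞) f)
    (hfc : HasCompactSupport f) :
    ∃ C, 0 ≤ C ∧ (∀ x, ‖f x‖ ≤ C) ∧ ∀ x, ‖fderiv ℝ f x‖ ≤ C := by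
  obtain ⟨C₁, h₁⟩ := hfc.exists_bound_of_continuous hf.continuous
  obtain ⟨C₂, h₂⟩ := (hfc.fderiv (𝕜 := ℝ)).exists_bound_of_continuous
    (hf.continuous_fderiv (by simp))
  refine ⟨max C₁ C₂, ?_, fun x => (h₁ x).trans (le_max_left _ _),
    fun x => (h₂ x).trans (le_max_right _ _)⟩
  exact (norm_nonneg _).trans ((h₁ 0).trans (le_max_left _ _))

/-- The test function `χ(x - y) Λ(G(x))`. -/
def localTest (χ : Space d → ℝ) (Λ : ℂ → ℂ) (G : Space d → ℂ) (y x : Space d) : ℂ :=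
  χ (x - y) * Λ (G x)

theorem isTestFunction_localTest {χ : Space d → ℝ} (hχ : ContDiff ℝ (⊤ : ℕ∞) χ)
    (hχc : HasCompactSupport χ) {Λ : ℂ → ℂ} (hΛ : ContDiff ℝ (⊤ : ℕ∞) Λ) {G : Space d → ℂ}
    (hG : ContDiff ℝ (⊤ : ℕ∞) G) (y : Space d) : IsTestFunction (localTest χ Λ G y) := by
  refine ⟨(Complex.ofRealCLM.contDiff.comp (hχ.comp (contDiff_id.sub contDiff_const))).mul
    (hΛ.comp hG), ?_⟩
  exact ((hχc.comp_homeomorph (Homeomorph.subRight y)).comp_left Complex.ofReal_zero).mul_right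

theorem partialDeriv_localTest {χ : Space d → ℝ} (hχ : ContDiff ℝ (⊤ : ℕ∞) χ)
    {Λ : ℂ → ℂ} (hΛ : ContDiff ℝ (⊤ : ℕ∞) Λ) {G : Space d → ℂ}
    (hG : ContDiff ℝ (⊤ : ℕ∞) G) (y x : Space d) (i : Fin d) :
    partialDeriv i (localTest χ Λ G y) x =
      (fderiv ℝ χ (x - y) (EuclideanSpace.single i 1) : ℝ) * Λ (G x) +
        χ (x - y) * fderiv ℝ Λ (G x) (partialDeriv i G x) := by
  have h1 : HasFDerivAt (fun x => (χ (x - y) : ℂ))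
      (Complex.ofRealCLM.comp (fderiv ℝ χ (x - y))) x := by
    have := (hχ.differentiable (by simp) (x - y)).hasFDerivAt.comp x
      ((hasFDerivAt_id x).sub_const y)
    exact Complex.ofRealCLM.hasFDerivAt.comp x this
  have h2 := (hΛ.differentiable (by simp) (G x)).hasFDerivAt.comp x
    (hG.differentiable (by simp) x).hasFDerivAt
  have h3 := (h1.mul h2).fderiv
  have h4 : partialDeriv i (localTest χ Λ G y) x = _ :=
    congrArg (fun l : Space d →L[ℝ] ℂ => l (EuclideanSpace.single i 1)) h3
  rw [h4]
  simp [partialDeriv]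
  ring

/-! ### Estimates on a unit ball of small energy -/

theorem integrableOn_const_add_div {w : Space d → ℝ} (hw : Integrable w) (y : Space d) (η : ℝ) :
    IntegrableOn (fun x => η + w x / η) (Metric.closedBall y 1) :=
  (integrableOn_const measure_closedBall_lt_top.ne).add (hw.integrableOn.div_const η)

theorem setIntegral_const_add_div_le {w : Space d → ℝ} (hw : Integrable w) {y : Space d} {η : ℝ}
    (hη : 0 < η) (hS : ∫ x in Metric.closedBall y 1, w x ≤ η ^ 2) :
    ∫ x in Metric.closedBall y 1, (η + w x / η) ≤
      (volume.real (Metric.closedBall (0 : Space d) 1) + 1) * η := by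
  have hV : volume.real (Metric.closedBall y 1) =
      volume.real (Metric.closedBall (0 : Space d) 1) := by
    simp only [Measure.real, Measure.addHaar_closedBall_center volume y]
  have hS' : (∫ x in Metric.closedBall y 1, w x) / η ≤ η := by
    rw [div_le_iff₀ hη]; nlinarith
  have hc : IntegrableOn (fun _ => η) (Metric.closedBall y 1) :=
    integrableOn_const measure_closedBall_lt_top.ne
  rw [integral_add hc (hw.integrableOn.div_const η),
    setIntegral_const, integral_div, smul_eq_mul, hV]
  linarith

/-- On a unit ball where the energy is at most `η²`, the bound `η + w / η` integrates to `O(η)`; the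
term with `h`, which is not localized, carries a factor `η` itself. -/
theorem norm_integral_le_of_closedBall_bound {w h : Space d → ℝ} (hw : Integrable w)
    (hh : Integrable h) {y : Space d} {a b η : ℝ} (ha : 0 ≤ a) (hη : 0 < η)
    (hS : ∫ x in Metric.closedBall y 1, w x ≤ η ^ 2) {f : Space d → ℂ}
    (hf : ∀ x, ‖f x‖ ≤ (Metric.closedBall y 1).indicator (fun x => a * (η + w x / η)) x +
      b * (η * h x)) :
    ‖∫ x, f x‖ ≤ (a * (volume.real (Metric.closedBall (0 : Space d) 1) + 1) + b * ∫ x, h x) * η := by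
  have hB : MeasurableSet (Metric.closedBall y 1) := Metric.isClosed_closedBall.measurableSet
  have hi := (integrable_indicator_iff hB).2 ((integrableOn_const_add_div hw y η).const_mul a)
  refine (norm_integral_le_of_norm_le (hi.add ((hh.const_mul η).const_mul b))
    (Eventually.of_forall hf)).trans ?_
  rw [integral_add' hi ((hh.const_mul η).const_mul b),
    integral_indicator hB, integral_const_mul, integral_const_mul, integral_const_mul]
  have := mul_le_mul_of_nonneg_left (setIntegral_const_add_div_le hw hη hS) ha
  linarith

/-- A mollifier: a nonnegative test function of unit integral. -/
structure IsMollifier (ρ : Space d → ℝ) : Prop where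
  contDiff : ContDiff ℝ (⊤ : ℕ∞) ρ
  hasCompactSupport : HasCompactSupport ρ
  nonneg : ∀ x, 0 ≤ ρ x
  integral_eq_one : ∫ x, ρ x = 1

theorem exists_mollifier_tendsto_ae {φ : Space d → ℂ} (hφ : LocallyIntegrable φ volume) :
    ∃ ρ : ℕ → Space d → ℝ, (∀ n, IsMollifier (ρ n)) ∧ ∀ᵐ x,
      Tendsto (fun n => (ρ n ⋆[ContinuousLinearMap.lsmul ℝ ℝ, volume] φ) x) atTop (𝓝 (φ x)) := by
  let b : ℕ → ContDiffBump (0 : Space d) := fun n =>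
    ⟨1 / (n + 1 : ℝ), 2 * (1 / (n + 1 : ℝ)), by positivity, by
      have : (0 : ℝ) < 1 / (n + 1 : ℝ) := by positivity
      linarith⟩
  refine ⟨fun n => (b n).normed volume, fun n => ⟨(b n).contDiff_normed,
    (b n).hasCompactSupport_normed, (b n).nonneg_normed, (b n).integral_normed⟩, ?_⟩
  refine ContDiffBump.ae_convolution_tendsto_right_of_locallyIntegrable (K := 2) ?_
    (Eventually.of_forall fun n => le_rfl) hφ
  have := (tendsto_one_div_add_atTop_nhds_zero_nat (𝕜 := ℝ)).const_mul 2
  rwa [mul_zero] at this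

/-- The upper bound for the term `ω ∫ φ ψ` of the stationary equation, tested on a unit ball of
small energy, uniformly with respect to the mollifier. -/
theorem exists_norm_mul_integral_localTest_le {lam ω : ℝ} {c : Space d} {φ : Space d → ℂ}
    {g : Space d → EuclideanSpace ℂ (Fin d)} (hg : HasWeakGradient φ g)
    (hg2 : Integrable fun x => ‖g x‖ ^ 2)
    (hP : Integrable fun x => potential (‖φ x‖ ^ 2))
    (hstat : ∀ ψ, IsTestFunction ψ → ω * ∫ x, φ x * ψ x =
      -Complex.I * (∑ i, c i * ∫ x, g x i * ψ x)
      - (∑ i, ∫ x, g x i * partialDeriv i ψ x) - lam * ∫ x, zlog (φ x) * ψ x)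
    {χ : Space d → ℝ} (hχ : ContDiff ℝ (⊤ : ℕ∞) χ) (hχc : HasCompactSupport χ)
    (hχ0 : ∀ x, 0 ≤ χ x) (hχ1 : ∀ x, χ x ≤ 1) (hχB : tsupport χ ⊆ Metric.closedBall 0 1)
    {Λ : ℂ → ℂ} (hΛ : ContDiff ℝ (⊤ : ℕ∞) Λ) (hΛc : HasCompactSupport Λ) :
    ∃ K, ∀ (y : Space d) (η : ℝ), 0 < η → η ≤ 1 →
      ∫ x in Metric.closedBall y 1, (‖g x‖ ^ 2 + potential (‖φ x‖ ^ 2)) ≤ η ^ 2 →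
      ∀ ρ : Space d → ℝ, IsMollifier ρ →
      ‖ω * ∫ x, φ x *
        localTest χ Λ (ρ ⋆[ContinuousLinearMap.lsmul ℝ ℝ, volume] φ) y x‖ ≤ K * η := by
  obtain ⟨C, hC0, hC, hC'⟩ := exists_bound_fderiv hΛ hΛc
  obtain ⟨D, hD0, -, hD'⟩ := exists_bound_fderiv hχ hχc
  set V := volume.real (Metric.closedBall (0 : Space d) 1)
  set M := ∫ x, ‖g x‖ ^ 2
  refine ⟨(∑ i, |c i|) * (C * (V + 1)) + d * ((D * C + C) * (V + 1) + C * M) +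
    |lam| * (4 * C * (V + 1)), fun y η hη hη1 hS ρ hρ => ?_⟩
  set w : Space d → ℝ := fun x => ‖g x‖ ^ 2 + potential (‖φ x‖ ^ 2) with hwdef
  have hw : Integrable w := hg2.add hP
  set G := ρ ⋆[ContinuousLinearMap.lsmul ℝ ℝ, volume] φ
  set h := ρ ⋆[ContinuousLinearMap.lsmul ℝ ℝ, volume] fun x => ‖g x‖ ^ 2
  have hρi : Integrable ρ := hρ.contDiff.continuous.integrable_of_hasCompactSupport
    hρ.hasCompactSupport
  have hh : Integrable h := hρi.integrable_convolution _ hg2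
  have hh0 : ∀ x, 0 ≤ h x := fun x => integral_nonneg fun t =>
    mul_nonneg (hρ.nonneg t) (by positivity)
  have hhM : ∫ x, h x = M := by
    rw [integral_convolution _ hρi hg2, hρ.integral_eq_one]
    simp [M]
  have hG : ContDiff ℝ (⊤ : ℕ∞) G :=
    hρ.hasCompactSupport.contDiff_convolution_left _ hρ.contDiff hg.locallyIntegrable
  have hψ := isTestFunction_localTest hχ hχc hΛ hG y
  set ψ := localTest χ Λ G y with hψdef
  have hP0 : ∀ x, 0 ≤ potential (‖φ x‖ ^ 2) := fun x => potential_nonneg (by positivity)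
  have hχout : ∀ x ∉ Metric.closedBall y 1, x - y ∉ tsupport χ := fun x hx hx' =>
    hx (by simpa [dist_eq_norm] using hχB hx')
  have hχz : ∀ x ∉ Metric.closedBall y 1, χ (x - y) = 0 := fun x hx =>
    image_eq_zero_of_notMem_tsupport (hχout x hx)
  have hχz' : ∀ x ∉ Metric.closedBall y 1, fderiv ℝ χ (x - y) = 0 := fun x hx =>
    image_eq_zero_of_notMem_tsupport fun hx' => hχout x hx (tsupport_fderiv_subset ℝ hx')
  have hψC : ∀ x, ‖ψ x‖ ≤ C := fun x => by
    rw [hψdef, localTest, norm_mul, Complex.norm_real, Real.norm_of_nonneg (hχ0 _)]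
    exact (mul_le_of_le_one_left (norm_nonneg _) (hχ1 _)).trans (hC _)
  have hψz : ∀ x ∉ Metric.closedBall y 1, ψ x = 0 := fun x hx => by
    simp [hψdef, localTest, hχz x hx]
  have hgw : ∀ x, ‖g x‖ ^ 2 ≤ w x := fun x => le_add_of_nonneg_right (hP0 x)
  have hgη : ∀ x, ‖g x‖ ≤ η + w x / η := fun x => by
    have := abs_le_add_sq_div hη ‖g x‖
    rw [abs_norm] at this
    exact this.trans (by gcongr; exact hgw x)
  -- the convective term
  have b1 : ∀ i, ‖∫ x, g x i * ψ x‖ ≤ (C * (V + 1)) * η := fun i => by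
    rw [← add_zero (C * (V + 1)), ← zero_mul (∫ x, h x)]
    refine norm_integral_le_of_closedBall_bound hw hh hC0 hη hS fun x => ?_
    by_cases hx : x ∈ Metric.closedBall y 1
    · rw [indicator_of_mem hx, norm_mul, zero_mul, add_zero, mul_comm]
      exact mul_le_mul (hψC x) ((PiLp.norm_apply_le (g x) i).trans (hgη x)) (norm_nonneg _) hC0
    · simp [indicator_of_notMem hx, hψz x hx]
  -- the second-order term
  have b2 : ∀ i, ‖∫ x, g x i * partialDeriv i ψ x‖ ≤ ((D * C + C) * (V + 1) + C * M) * η :=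
      fun i => by
    rw [← hhM]
    refine norm_integral_le_of_closedBall_bound hw hh (by positivity) hη hS fun x => ?_
    rw [hψdef, partialDeriv_localTest hχ hΛ hG]
    by_cases hx : x ∈ Metric.closedBall y 1
    · rw [indicator_of_mem hx]
      have e1 : ‖(((fderiv ℝ χ (x - y)) (EuclideanSpace.single i 1) : ℝ) : ℂ) * Λ (G x)‖ ≤
          D * C := by
        rw [norm_mul, Complex.norm_real]
        refine mul_le_mul ?_ (hC _) (norm_nonneg _) hD0
        refine (ContinuousLinearMap.le_opNorm _ _).trans ?_
        simpa using hD' (x - y)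
      have e2 : ‖(χ (x - y) : ℂ) * fderiv ℝ Λ (G x) (partialDeriv i G x)‖ ≤
          C * ‖partialDeriv i G x‖ := by
        rw [norm_mul, Complex.norm_real, Real.norm_of_nonneg (hχ0 _)]
        refine (mul_le_of_le_one_left (norm_nonneg _) (hχ1 _)).trans ?_
        exact (ContinuousLinearMap.le_opNorm _ _).trans (by gcongr; exact hC' _)
      have e3 := mul_norm_partialDeriv_convolution_le hg hg2 hρ.contDiff hρ.hasCompactSupport
        hρ.nonneg hρ.integral_eq_one i x (norm_nonneg (g x)) hη
      have e4 : ‖g x‖ ^ 2 / η ≤ η + w x / η := by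
        have : ‖g x‖ ^ 2 / η ≤ w x / η := by gcongr; exact hgw x
        linarith
      rw [norm_mul]
      calc ‖g x i‖ * _ ≤ ‖g x‖ * (D * C + C * ‖partialDeriv i G x‖) :=
            mul_le_mul (PiLp.norm_apply_le (g x) i) ((norm_add_le _ _).trans (add_le_add e1 e2))
              (norm_nonneg _) (norm_nonneg _)
        _ = D * C * ‖g x‖ + C * (‖g x‖ * ‖partialDeriv i G x‖) := by ring
        _ ≤ D * C * (η + w x / η) + C * ((η + w x / η) + η * h x) := by
            refine add_le_add (mul_le_mul_of_nonneg_left (hgη x) (by positivity))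
              (mul_le_mul_of_nonneg_left (e3.trans ?_) hC0)
            exact add_le_add e4 le_rfl
        _ = _ := by ring
    · rw [indicator_of_notMem hx, hχz x hx, hχz' x hx]
      simpa using mul_nonneg hC0 (mul_nonneg hη.le (hh0 x))
  -- the nonlinear term
  have b3 : ‖∫ x, zlog (φ x) * ψ x‖ ≤ (4 * C * (V + 1)) * η := by
    rw [← add_zero (4 * C * (V + 1)), ← zero_mul (∫ x, h x)]
    refine norm_integral_le_of_closedBall_bound hw hh (by positivity) hη hS fun x => ?_
    by_cases hx : x ∈ Metric.closedBall y 1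
    · rw [indicator_of_mem hx, norm_mul, zero_mul, add_zero]
      have e1 : (‖φ x‖ - 1) ^ 2 ≤ w x := (sq_sub_one_le_potential (norm_nonneg _)).trans
        (le_add_of_nonneg_left (by positivity))
      have e2 : (‖φ x‖ - 1) ^ 2 / η ≤ w x / η := by gcongr
      have e3 := abs_le_add_sq_div hη (‖φ x‖ - 1)
      have e4 : w x ≤ w x / η := le_div_self ((sq_nonneg _).trans e1) hη hη1
      have e5 : ‖zlog (φ x)‖ ≤ 4 * (η + w x / η) := (norm_zlog_le _).trans (by linarith)
      calc _ ≤ 4 * (η + w x / η) * C :=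
            mul_le_mul e5 (hψC x) (norm_nonneg _) ((norm_nonneg _).trans e5)
        _ = _ := by ring
    · simp [indicator_of_notMem hx, hψz x hx]
  rw [hstat ψ hψ]
  have t1 : ‖-Complex.I * (∑ i, c i * ∫ x, g x i * ψ x)‖ ≤
      ∑ i, |c i| * (C * (V + 1)) * η := by
    rw [norm_mul, norm_neg, Complex.norm_I, one_mul]
    refine norm_sum_le_of_le _ fun i _ => ?_
    rw [norm_mul, Complex.norm_real, Real.norm_eq_abs]
    exact (mul_le_mul_of_nonneg_left (b1 i) (abs_nonneg _)).trans_eq (mul_assoc _ _ _).symm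
  have t2 := norm_sum_le_of_le Finset.univ fun i _ => b2 i
  have t3 : ‖lam * ∫ x, zlog (φ x) * ψ x‖ ≤ |lam| * ((4 * C * (V + 1)) * η) := by
    rw [norm_mul, Complex.norm_real, Real.norm_eq_abs]
    exact mul_le_mul_of_nonneg_left b3 (abs_nonneg _)
  refine (norm_sub_le_of_le (norm_sub_le_of_le t1 t2) t3).trans (le_of_eq ?_)
  rw [← Finset.sum_mul, ← Finset.sum_mul, Finset.sum_const, Finset.card_univ, Fintype.card_fin,
    nsmul_eq_mul]
  ring

/-- On a unit ball of small energy, `|φ|` is close to `1` in the mean, which bounds the limit of the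
left-hand side of the tested equation from below. -/
theorem le_norm_integral_localTest {φ : Space d → ℂ}
    {w : Space d → ℝ} (hw : Integrable w) (hφw : ∀ x, (‖φ x‖ - 1) ^ 2 ≤ w x)
    {χ : Space d → ℝ} (hχ : ContDiff ℝ (⊤ : ℕ∞) χ) (hχc : HasCompactSupport χ)
    (hχ0 : ∀ x, 0 ≤ χ x) (hχ1 : ∀ x, χ x ≤ 1) (hχB : tsupport χ ⊆ Metric.closedBall 0 1)
    {Λ : ℂ → ℂ} (hΛ : ∀ z, 1 - 2 * |‖z‖ - 1| ≤ (z * Λ z).re) {y : Space d}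
    (hint : Integrable fun x => φ x * localTest χ Λ φ y x) {η : ℝ} (hη : 0 < η)
    (hS : ∫ x in Metric.closedBall y 1, w x ≤ η ^ 2) :
    (∫ x, χ x) - 2 * ((volume.real (Metric.closedBall (0 : Space d) 1) + 1) * η) ≤
      ‖∫ x, φ x * localTest χ Λ φ y x‖ := by
  have hB : MeasurableSet (Metric.closedBall y 1) := Metric.isClosed_closedBall.measurableSet
  have hχi : Integrable fun x => χ (x - y) :=
    (hχ.continuous.integrable_of_hasCompactSupport hχc).comp_sub_right y
  have hi := (integrable_indicator_iff hB).2 (integrableOn_const_add_div hw y η)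
  calc (∫ x, χ x) - 2 * ((volume.real (Metric.closedBall (0 : Space d) 1) + 1) * η)
      ≤ (∫ x, χ (x - y)) - 2 * ∫ x, (Metric.closedBall y 1).indicator (fun x => η + w x / η) x := by
        rw [integral_sub_right_eq_self, integral_indicator hB]
        have := setIntegral_const_add_div_le hw hη hS
        linarith
    _ = ∫ x, (χ (x - y) - 2 * (Metric.closedBall y 1).indicator (fun x => η + w x / η) x) := by
        rw [integral_sub hχi (hi.const_mul 2), integral_const_mul]
    _ ≤ ∫ x, (φ x * localTest χ Λ φ y x).re := by
        refine integral_mono (hχi.sub (hi.const_mul 2)) hint.re fun x => ?_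
        have e : (φ x * localTest χ Λ φ y x).re = χ (x - y) * (φ x * Λ (φ x)).re := by
          rw [localTest, mul_left_comm, Complex.re_ofReal_mul]
        dsimp only
        rw [e]
        by_cases hx : x ∈ Metric.closedBall y 1
        · rw [indicator_of_mem hx]
          have h1 := mul_le_mul_of_nonneg_left (hΛ (φ x)) (hχ0 (x - y))
          have h2 := mul_le_mul_of_nonneg_right (hχ1 (x - y)) (abs_nonneg (‖φ x‖ - 1))
          have h3 := abs_le_add_sq_div hη (‖φ x‖ - 1)
          have h4 : (‖φ x‖ - 1) ^ 2 / η ≤ w x / η := by gcongr; exact hφw x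
          linarith
        · have : χ (x - y) = 0 := image_eq_zero_of_notMem_tsupport fun hx' =>
            hx (by simpa [dist_eq_norm] using hχB hx')
          rw [indicator_of_notMem hx, this]
          simp
    _ = (∫ x, φ x * localTest χ Λ φ y x).re := integral_re hint
    _ ≤ _ := Complex.re_le_norm _

/-- Removing the mollification from the tested function. -/
theorem tendsto_integral_localTest {φ : Space d → ℂ} (hφ : LocallyIntegrable φ volume)
    {χ : Space d → ℝ} (hχ : ContDiff ℝ (⊤ : ℕ∞) χ) (hχc : HasCompactSupport χ)
    {Λ : ℂ → ℂ} (hΛ : Continuous Λ) {C : ℝ} (hC : ∀ z, ‖Λ z‖ ≤ C) (y : Space d)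
    {G : ℕ → Space d → ℂ} (hG : ∀ n, Continuous (G n))
    (hlim : ∀ᵐ x, Tendsto (fun n => G n x) atTop (𝓝 (φ x))) :
    (Integrable fun x => φ x * localTest χ Λ φ y x) ∧
    Tendsto (fun n => ∫ x, φ x * localTest χ Λ (G n) y x) atTop
      (𝓝 (∫ x, φ x * localTest χ Λ φ y x)) := by
  have hc : Continuous fun x => χ (x - y) := hχ.continuous.comp (by fun_prop)
  have hcs : HasCompactSupport fun x => χ (x - y) := hχc.comp_homeomorph (Homeomorph.subRight y)
  have hbd : Integrable fun x => C * ‖χ (x - y) • φ x‖ :=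
    (hφ.integrable_smul_left_of_hasCompactSupport hc hcs).norm.const_mul C
  have hle : ∀ (F : Space d → ℂ) x, ‖φ x * localTest χ Λ F y x‖ ≤ C * ‖χ (x - y) • φ x‖ :=
    fun F x => by
      rw [localTest, norm_mul, norm_mul, Complex.norm_real, norm_smul]
      calc _ = ‖Λ (F x)‖ * (‖χ (x - y)‖ * ‖φ x‖) := by ring
        _ ≤ _ := by gcongr; exact hC _
  have hm : ∀ F : Space d → ℂ, AEStronglyMeasurable F →
      AEStronglyMeasurable fun x => φ x * localTest χ Λ F y x := fun F hF =>
    hφ.aestronglyMeasurable.mul ((Complex.continuous_ofReal.comp hc).aestronglyMeasurable.mul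
      (hΛ.comp_aestronglyMeasurable hF))
  refine ⟨hbd.mono' (hm _ hφ.aestronglyMeasurable) (Eventually.of_forall (hle φ)),
    tendsto_integral_of_dominated_convergence _ (fun n => hm _ (hG n).aestronglyMeasurable) hbd
      (fun n => Eventually.of_forall (hle (G n))) ?_⟩
  filter_upwards [hlim] with x hx
  exact (((hΛ.tendsto _).comp hx).const_mul _).const_mul _

end LogGP

end

theorem mainTheorem3 (d : ℕ) (hd : 1 ≤ d) (lam : ℝ) (hlam : 0 < lam)
    (I : Set ℝ) (hIopen : IsOpen I) (hIinterval : I.OrdConnected) (hI0 : (0 : ℝ) ∈ I)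
    (ω : ℝ) (c : LogGP.Space d) (φ : LogGP.Space d → ℂ) (hφ : φ ∈ LogGP.EnergySpace d lam)
    (u₀ : LogGP.Space d → ℂ) (hu₀ : u₀ ∈ LogGP.EnergySpace d lam)
    (u : ℝ → LogGP.Space d → ℂ) (hu : LogGP.IsWeakSolution lam I u₀ u)
    (hwave : ∀ᵐ z : ℝ × LogGP.Space d ∂(volume.restrict (I ×ˢ univ)),
      u z.1 z.2 = LogGP.travelingWave ω c φ z.1 z.2) :
    ω = 0 := by
  obtain ⟨g, hg, hg2, hP⟩ := LogGP.exists_integrable_density hlam hφ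
  obtain ⟨χ, hχ, hχc, hχ0, hχ1, hχB, hχpos⟩ := LogGP.exists_unit_cutoff d
  obtain ⟨Λ, hΛ, hΛc, hΛre⟩ := LogGP.exists_truncated_conj
  obtain ⟨C, -, hC, -⟩ := LogGP.exists_bound_fderiv hΛ hΛc
  obtain ⟨ρ, hρ, hlim⟩ := LogGP.exists_mollifier_tendsto_ae hg.locallyIntegrable
  obtain ⟨K, hK⟩ := LogGP.exists_norm_mul_integral_localTest_le hg hg2 hP
    (fun ψ hψ => hu.stationary_grad hIopen hI0 hg hwave hψ) hχ hχc hχ0 hχ1 hχB hΛ hΛc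
  have hw := hg2.add hP
  set V := volume.real (Metric.closedBall (0 : LogGP.Space d) 1)
  have key : ∀ η : ℝ, 0 < η → η ≤ 1 → |ω| * ((∫ x, χ x) - 2 * ((V + 1) * η)) ≤ K * η := by
    intro η hη hη1
    obtain ⟨y, hy⟩ := LogGP.exists_setIntegral_closedBall_le hd hw (pow_pos hη 2)
    obtain ⟨hint, htend⟩ := LogGP.tendsto_integral_localTest hg.locallyIntegrable hχ hχc
      hΛ.continuous hC y (fun n => ((hρ n).hasCompactSupport.contDiff_convolution_left _
        (hρ n).contDiff hg.locallyIntegrable).continuous) hlim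
    have hlow := LogGP.le_norm_integral_localTest hw
      (fun x => (LogGP.sq_sub_one_le_potential (norm_nonneg (φ x))).trans
        (le_add_of_nonneg_left (by positivity))) hχ hχc hχ0 hχ1 hχB hΛre hint hη hy
    have hup := le_of_tendsto (htend.const_mul (ω : ℂ)).norm
      (Eventually.of_forall fun n => hK y η hη hη1 hy (ρ n) (hρ n))
    rw [norm_mul, Complex.norm_real, Real.norm_eq_abs] at hup
    exact (mul_le_mul_of_nonneg_left hlow (abs_nonneg ω)).trans hup
  have hl : Tendsto (fun η : ℝ => |ω| * ((∫ x, χ x) - 2 * ((V + 1) * η))) (𝓝[>] 0)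
      (𝓝 (|ω| * ((∫ x, χ x) - 2 * ((V + 1) * 0)))) :=
    (Continuous.tendsto (by fun_prop) 0).mono_left nhdsWithin_le_nhds
  have hr : Tendsto (fun η : ℝ => K * η) (𝓝[>] 0) (𝓝 (K * 0)) :=
    (Continuous.tendsto (by fun_prop) 0).mono_left nhdsWithin_le_nhds
  have hle := le_of_tendsto_of_tendsto hl hr (by
    filter_upwards [Ioc_mem_nhdsGT (zero_lt_one' ℝ)] with η hη using key η hη.1 hη.2)
  rw [mul_zero, mul_zero, mul_zero, sub_zero] at hle
  exact abs_eq_zero.1 (le_antisymm (nonpos_of_mul_nonpos_left hle hχpos) (abs_nonneg ω))
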